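/- Let $\alpha>0$ and $\beta>1$. For $n\ge 1$ let $\mathbb T_n=\mathbb Z/n\mathbb Z$ and $g(n)=\alpha n^{-\beta}$, and let $\mathfrak L_n$ be the generator of the symmetric exclusion process with a slow site at $0$: for $f:\{0,1\}^{\mathbb T_n}\to\mathbb R$, $$\mathfrak L_n f(\eta)=\sum_{x,y\in\mathbb T_n,\ |x-y|\le 1}\xi^n_x\,\eta(x)\,(1-\eta(y))\,[f(\eta^{x,y})-f(\eta)],$$ where $\xi^n_0=g(n)$, $\xi^n_x=1$ for $x\ne 0$, and $\eta^{x,y}$ is obtained from $\eta$ by exchanging $\eta(x)$ and $\eta(y)$. Let $\mathbb T=\mathbb R/\mathbb Z$ and let $\gamma:\mathbb T\to[0,1]$ be continuous at every point of $\mathbb T\setminus\{0\}$, with $\inf_{x\in\mathbb T}\gamma(x)>0$. Let $\mu_n$ be the product measure on $\{0,1\}^{\mathbb T_n}$ with $\mu_n\{\eta:\eta(x)=1\}=\gamma(x/n)$ for all $x\in\mathbb T_n$, and let $\mathbb P_{\mu_n}$ be the law, on the space of càdlàg paths $[0,\infty)\to\{0,1\}^{\mathbb T_n}$, of the Markov process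 $(\eta_t)_{t\ge 0}$ with generator $n^2\mathfrak L_n$ and initial law $\mu_n$. Then, for all $t>0$ and $\varepsilon>0$, $$\lim_{n\to\infty}\mathbb P_{\mu_n}\Big\{\eta_\cdot:\ \frac nt\int_0^t\big(1-\eta_s(0)\big)\,ds>\varepsilon\Big\}=0.$$ -/

import Mathlib

open MeasureTheory Filter Topology
open scoped NNReal

namespace SlowSite

noncomputable section

/-- Configurations `{0,1}^{T_n}` on the discrete torus `T_n = ℤ/nℤ`; `η x = true` means that the
site `x` is occupied. -/
abbrev Config (n : ℕ) : Type := ZMod n → Bool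

/-- The occupation variable `η(x) ∈ {0,1}`, as a real number. -/
def occ {n : ℕ} (η : Config n) (x : ZMod n) : ℝ := if η x then 1 else 0

/-- The configuration `η^{x,y}`: the occupation variables at `x` and `y` are exchanged. -/
def exchange {n : ℕ} (η : Config n) (x y : ZMod n) : Config n := fun z => η (Equiv.swap x y z)

/-- The jump rate `ξ_x` out of the site `x`: it is `g` at the slow site `0` and `1` elsewhere. -/
def rate {n : ℕ} (g : ℝ) (x : ZMod n) : ℝ := if x = 0 then g else 1

/-- `|x - y| ≤ 1` on the discrete torus. -/
abbrev Near {n : ℕ} (x y : ZMod n) : Prop := x - y = -1 ∨ x - y = 0 ∨ x - y = 1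

/-- The generator of the exclusion process with slow site,
`(L f)(η) = ∑_{|x - y| ≤ 1} ξ_x η(x) (1 - η(y)) [f(η^{x,y}) - f(η)]`. -/
def generator (n : ℕ) [NeZero n] (g : ℝ) : (Config n → ℝ) →ₗ[ℝ] (Config n → ℝ) where
  toFun f η := ∑ p : ZMod n × ZMod n with Near p.1 p.2,
    rate g p.1 * occ η p.1 * (1 - occ η p.2) * (f (exchange η p.1 p.2) - f η)
  map_add' f h := by
    funext η
    simp only [Pi.add_apply, ← Finset.sum_add_distrib]
    exact Finset.sum_congr rfl fun _ _ => by ring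
  map_smul' c f := by
    funext η
    simp only [Pi.smul_apply, smul_eq_mul, RingHom.id_apply, Finset.mul_sum]
    exact Finset.sum_congr rfl fun _ _ => by ring

/-- The Markov semigroup `exp (t • n² L) f` of the process accelerated by the factor `n²`; since
the state space is finite, the exponential is that of the matrix of the generator. -/
def semigroup (n : ℕ) [NeZero n] (g : ℝ) (t : ℝ≥0) (f : Config n → ℝ) : Config n → ℝ :=
  Matrix.mulVec
    (NormedSpace.exp (((t : ℝ) * (n : ℝ) ^ 2) • LinearMap.toMatrix' (generator n g))) f

/-- Right-continuous functions on `[0,∞)` with left limits. (At time `0` the left limit condition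
is void.) -/
def IsCadlag {E : Type*} [TopologicalSpace E] (ω : ℝ≥0 → E) : Prop :=
  ∀ t, ContinuousWithinAt ω (Set.Ici t) t ∧ ∃ l, Tendsto ω (𝓝[<] t) (𝓝 l)

/-- The path space `D([0,∞), {0,1}^{T_n})`. As a subtype of a product it carries the σ-algebra
generated by the coordinates, which is the Borel σ-algebra of the Skorohod topology. -/
abbrev Path (n : ℕ) : Type := {ω : ℝ≥0 → Config n // IsCadlag ω}

/-- The σ-algebra generated by the path up to time `s`. -/
abbrev past (n : ℕ) (s : ℝ≥0) : MeasurableSpace (Path n) :=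
  ⨆ u ∈ Set.Iic s, MeasurableSpace.comap (fun ω : Path n => ω.1 u) inferInstance

theorem past_le (n : ℕ) (s : ℝ≥0) : past n s ≤ (inferInstance : MeasurableSpace (Path n)) :=
  iSup₂_le fun u _ => ((measurable_pi_apply u).comp measurable_subtype_coe).comap_le

/-- `P` is the law `ℙ_μ` on path space of the Markov process with generator `n² L` and initial
law `μ`: the law at time `0` is `μ`, and the coordinate process has the Markov property with
semigroup `exp (t n² L)`. -/
structure IsPathLaw (n : ℕ) [NeZero n] (g : ℝ) (μ : Measure (Config n)) (P : Measure (Path n)) :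
    Prop where
  isProbabilityMeasure : IsProbabilityMeasure P
  initial : P.map (fun ω => ω.1 0) = μ
  markov : ∀ (s t : ℝ≥0) (f : Config n → ℝ),
    P[fun ω => f (ω.1 (s + t)) | past n s] =ᵐ[P] fun ω => semigroup n g t f (ω.1 s)

/-- The Bernoulli product measure `μ_n` associated with the profile `γ`: the occupation variables
are independent and `μ_n {η(x) = 1} = γ(x/n)`. -/
def initialMeasure (n : ℕ) [NeZero n] (γ : UnitAddCircle → unitInterval) : Measure (Config n) :=
  Measure.pi fun x : ZMod n =>
    ProbabilityTheory.bernoulliMeasure true false (γ (ZMod.toAddCircle x))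

end

end SlowSite

/-! Let X be the distance from the slow site to the first particle at or to the right of it, so that
`emptyUpTo k` is the indicator of X > k. While X > 0, the first particle steps left at rate 1 and
right at rate at most 1. A concave increasing function V ≤ l² of X, constant beyond l, therefore has
drift at most -1{X > 0} + 1{X > l} + 3gl²; the last term pays for jumps out of the slow site
(`generator_lyapunov_le`). Dynkin's formula at speed n² bounds the expected time with a hole at 0 by
l²/n² + t(sup_s P(X_s > l) + 3gl²).

The tail of X is controlled uniformly in time by attractiveness (`exp_generator_monotone`). Lowering
the initial density to 0 at the slow site and to a constant ρ > 0 elsewhere can only increase the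
probability of an empty window. The lowered measure is at most ((1-ρ)g)⁻¹ times an invariant weight,
and that weight gives the empty window mass (1-ρ)g(1-ρ)^l. The small factor g cancels, leaving P(X_s
> l) ≤ (1-ρ)^l (`weight_dotProduct_exp_emptyUpTo_le`).

Markov's inequality costs a factor n. With l ≈ n^δ and δ small, n(l²/n²), n(1-ρ)^l and n·n^(-β)l²
all vanish, the last because β > 1. -/

namespace SlowSite

/-! ### Semigroups of finite matrices: invariant cones, invariant vectors, Dynkin's formula -/

section MatrixExponential

open Matrix NormedSpace

variable {ι : Type*} [Fintype ι] [DecidableEq ι]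

attribute [local instance] Matrix.linftyOpNormedRing Matrix.linftyOpNormedAlgebra

theorem hasDerivAt_dotProduct_exp_mulVec (A : Matrix ι ι ℝ) (m f : ι → ℝ) (s : ℝ) :
    HasDerivAt (fun s : ℝ => m ⬝ᵥ (exp (s • A) *ᵥ f)) (m ⬝ᵥ (exp (s • A) *ᵥ (A *ᵥ f))) s := by
  have h := hasDerivAt_exp_smul_const (𝕂 := ℝ) A s
  let T : Matrix ι ι ℝ →ₗ[ℝ] ℝ :=
    { toFun := fun M => m ⬝ᵥ (M *ᵥ f)
      map_add' := fun M N => by rw [add_mulVec, dotProduct_add]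
      map_smul' := fun c M => by rw [smul_mulVec, dotProduct_smul]; rfl }
  have h2 := (LinearMap.toContinuousLinearMap T).hasFDerivAt.comp_hasDerivAt s h
  rw [mulVec_mulVec]
  exact h2

/-- A closed convex cone that is stable under `B` is stable under `exp B`. -/
theorem exp_mulVec_mem (B : Matrix ι ι ℝ) (K : Set (ι → ℝ)) (hK : IsClosed K) (h0 : 0 ∈ K)
    (hadd : ∀ f ∈ K, ∀ g ∈ K, f + g ∈ K) (hsmul : ∀ c : ℝ, 0 ≤ c → ∀ f ∈ K, c • f ∈ K)
    (hB : ∀ f ∈ K, B *ᵥ f ∈ K) (f : ι → ℝ) (hf : f ∈ K) : exp B *ᵥ f ∈ K := by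
  have h := exp_series_hasSum_exp' (𝕂 := ℝ) B
  let T : Matrix ι ι ℝ →ₗ[ℝ] (ι → ℝ) :=
    { toFun := fun M => M *ᵥ f
      map_add' := fun M N => by rw [add_mulVec]
      map_smul' := fun c M => by rw [smul_mulVec]; rfl }
  have h2 := (LinearMap.toContinuousLinearMap T).hasSum h
  have hpow : ∀ k : ℕ, B ^ k *ᵥ f ∈ K := by
    intro k
    induction k with
    | zero => simpa using hf
    | succ k ih => rw [pow_succ', ← mulVec_mulVec]; exact hB _ ih
  refine hK.mem_of_tendsto h2 (Eventually.of_forall fun s => ?_)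
  induction s using Finset.induction_on with
  | empty => simpa using h0
  | insert a s ha ih =>
    rw [Finset.sum_insert ha]
    refine hadd _ ?_ _ ih
    change (((a.factorial : ℝ)⁻¹) • B ^ a) *ᵥ f ∈ K
    rw [smul_mulVec]
    exact hsmul _ (by positivity) _ (hpow a)

/-- A closed convex cone that is stable under `A + C` is stable under the semigroup of `A`. -/
theorem exp_smul_mulVec_mem (A : Matrix ι ι ℝ) (C : ℝ) (K : Set (ι → ℝ)) (hK : IsClosed K)
    (h0 : 0 ∈ K) (hadd : ∀ f ∈ K, ∀ g ∈ K, f + g ∈ K)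
    (hsmul : ∀ c : ℝ, 0 ≤ c → ∀ f ∈ K, c • f ∈ K)
    (hA : ∀ f ∈ K, A *ᵥ f + C • f ∈ K) (s : ℝ) (hs : 0 ≤ s) (f : ι → ℝ) (hf : f ∈ K) :
    exp (s • A) *ᵥ f ∈ K := by
  have h1 : exp (s • (A + C • (1 : Matrix ι ι ℝ))) *ᵥ f ∈ K := by
    refine exp_mulVec_mem _ K hK h0 hadd hsmul (fun f hf => ?_) f hf
    rw [smul_mulVec, add_mulVec, smul_mulVec, one_mulVec]
    exact hsmul s hs _ (hA f hf)
  -- The shift by C only multiplies the semigroup by the positive scalar e^(-sC), which a cone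
  -- tolerates.
  have h2 : s • A = s • (A + C • (1 : Matrix ι ι ℝ)) + (-(s * C)) • (1 : Matrix ι ι ℝ) := by
    module
  have h3 : exp ((-(s * C)) • (1 : Matrix ι ι ℝ)) = Real.exp (-(s * C)) • (1 : Matrix ι ι ℝ) := by
    have := algebraMap_exp_comm (𝔸 := Matrix ι ι ℝ) (-(s * C))
    rw [Algebra.algebraMap_eq_smul_one, Algebra.algebraMap_eq_smul_one] at this
    rw [Real.exp_eq_exp_ℝ]; exact this.symm
  rw [h2, Matrix.exp_add_of_commute _ _ ((Commute.one_right _).smul_right _), h3, mul_smul_comm,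
    mul_one, smul_mulVec]
  exact hsmul _ (Real.exp_pos _).le _ h1

/-- A vector annihilated by the generator from the left is invariant. -/
theorem dotProduct_exp_smul_mulVec (A : Matrix ι ι ℝ) (w : ι → ℝ)
    (hw : ∀ f, w ⬝ᵥ (A *ᵥ f) = 0) (s : ℝ) (f : ι → ℝ) :
    w ⬝ᵥ (exp (s • A) *ᵥ f) = w ⬝ᵥ f := by
  have hcomm : ∀ s : ℝ, exp (s • A) *ᵥ (A *ᵥ f) = A *ᵥ (exp (s • A) *ᵥ f) := fun s => by
    rw [mulVec_mulVec, mulVec_mulVec]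
    congr 1
    exact (((Commute.refl A).smul_left s).exp_left).eq
  have hd : ∀ s : ℝ, HasDerivAt (fun s : ℝ => w ⬝ᵥ (exp (s • A) *ᵥ f)) 0 s := fun s => by
    have := hasDerivAt_dotProduct_exp_mulVec A w f s
    rwa [hcomm, hw] at this
  have := is_const_of_deriv_eq_zero (fun s => (hd s).differentiableAt) (fun s => (hd s).deriv) s 0
  simpa using this

theorem exp_smul_mulVec_of_mulVec_eq_zero (A : Matrix ι ι ℝ) (f : ι → ℝ) (hf : A *ᵥ f = 0)
    (s : ℝ) : exp (s • A) *ᵥ f = f := by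
  funext i
  have hd : ∀ s : ℝ, HasDerivAt (fun s : ℝ => Pi.single i 1 ⬝ᵥ (exp (s • A) *ᵥ f)) 0 s :=
    fun s => by
      have := hasDerivAt_dotProduct_exp_mulVec A (Pi.single i 1) f s
      rwa [hf, mulVec_zero, dotProduct_zero] at this
  have := is_const_of_deriv_eq_zero (fun s => (hd s).differentiableAt) (fun s => (hd s).deriv) s 0
  simpa using this

/-- Dynkin's formula as a bound for the occupation time of `h` in terms of a Lyapunov function. -/
theorem integral_dotProduct_exp_le (A : Matrix ι ι ℝ) (m V h e : ι → ℝ) (b t : ℝ) (ht : 0 ≤ t)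
    (hm : ∀ f : ι → ℝ, 0 ≤ f → ∀ s : ℝ, 0 ≤ s → 0 ≤ m ⬝ᵥ (exp (s • A) *ᵥ f)) (hV : 0 ≤ V)
    (hL : ∀ x, (A *ᵥ V) x ≤ - h x + e x)
    (he : ∀ s : ℝ, 0 ≤ s → m ⬝ᵥ (exp (s • A) *ᵥ e) ≤ b) :
    ∫ s in (0 : ℝ)..t, m ⬝ᵥ (exp (s • A) *ᵥ h) ≤ m ⬝ᵥ V + b * t := by
  have hcont : ∀ f : ι → ℝ, Continuous fun s : ℝ => m ⬝ᵥ (exp (s • A) *ᵥ f) := fun f =>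
    continuous_iff_continuousAt.2 fun s => (hasDerivAt_dotProduct_exp_mulVec A m f s).continuousAt
  have h1 : ∫ s in (0 : ℝ)..t, m ⬝ᵥ (exp (s • A) *ᵥ (A *ᵥ V)) =
      m ⬝ᵥ (exp (t • A) *ᵥ V) - m ⬝ᵥ V := by
    rw [intervalIntegral.integral_eq_sub_of_hasDerivAt
      (fun s _ => hasDerivAt_dotProduct_exp_mulVec A m V s) ((hcont _).intervalIntegrable _ _)]
    simp
  have h2 : ∫ s in (0 : ℝ)..t, m ⬝ᵥ (exp (s • A) *ᵥ h) ≤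
      ∫ s in (0 : ℝ)..t, (b - m ⬝ᵥ (exp (s • A) *ᵥ (A *ᵥ V))) := by
    refine intervalIntegral.integral_mono_on ht ((hcont _).intervalIntegrable _ _)
      ((continuous_const.sub (hcont _)).intervalIntegrable _ _) fun s hs => ?_
    -- The Lyapunov inequality says that this function is nonnegative, and `hm` propagates that to
    -- time s.
    have h3 := hm (- h + e - A *ᵥ V) (fun x => by
      have := hL x
      simp only [Pi.zero_apply, Pi.sub_apply, Pi.add_apply, Pi.neg_apply]; linarith) s hs.1
    rw [mulVec_sub, mulVec_add, mulVec_neg, dotProduct_sub, dotProduct_add, dotProduct_neg] at h3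
    linarith [he s hs.1]
  rw [intervalIntegral.integral_sub (by simp) ((hcont _).intervalIntegrable _ _), h1] at h2
  simp only [intervalIntegral.integral_const, smul_eq_mul, sub_zero] at h2
  linarith [hm V hV t ht]

end MatrixExponential

end SlowSite

namespace SlowSite

/-! ### Attractiveness, stochastic order and reversibility -/

section Generator

open Matrix NormedSpace

variable {n : ℕ}

/-- The configuration after the particle at `p.1` (if any) has tried to jump to `p.2`. -/
def move (p : ZMod n × ZMod n) (η : Config n) : Config n :=
  if η p.1 = true ∧ η p.2 = false then exchange η p.1 p.2 else η

theorem exchange_apply (η : Config n) (x y z : ZMod n) :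
    exchange η x y z = if z = x then η y else if z = y then η x else η z := by
  unfold exchange
  rw [Equiv.swap_apply_def]
  split_ifs <;> rfl

theorem exchange_exchange (η : Config n) (x y : ZMod n) : exchange (exchange η x y) x y = η := by
  funext z; simp [exchange]

theorem exchange_comm (η : Config n) (x y : ZMod n) : exchange η x y = exchange η y x := by
  funext z; simp [exchange, Equiv.swap_comm]

theorem move_apply (p : ZMod n × ZMod n) (η : Config n) (z : ZMod n) :
    move p η z = if z = p.1 then (η p.1 && η p.2) else if z = p.2 then (η p.1 || η p.2)
      else η z := by
  unfold move
  split_ifs with h <;> (try rw [exchange_apply]) <;> grind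

/-- A jump replaces the two occupation variables by their conjunction and disjunction, both
monotone. This is the basic coupling behind attractiveness. -/
theorem monotone_move (p : ZMod n × ZMod n) : Monotone (move p) := by
  intro η ζ h z
  have h1 := h p.1
  have h2 := h p.2
  have h3 := h z
  rw [move_apply, move_apply]
  split_ifs
  · revert h1 h2; cases η p.1 <;> cases η p.2 <;> cases ζ p.1 <;> cases ζ p.2 <;> simp
  · revert h1 h2; cases η p.1 <;> cases η p.2 <;> cases ζ p.1 <;> cases ζ p.2 <;> simp
  · exact h3

theorem rate_nonneg {g : ℝ} (hg : 0 ≤ g) (x : ZMod n) : 0 ≤ rate g x := by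
  unfold rate; split_ifs <;> simp [hg]

variable [NeZero n]

/-- Once `move` absorbs the exclusion constraint, the rates no longer depend on the configuration,
so the same jump attempts can drive two ordered configurations. -/
theorem generator_apply (g : ℝ) (f : Config n → ℝ) (η : Config n) :
    generator n g f η = ∑ p : ZMod n × ZMod n with Near p.1 p.2,
      rate g p.1 * (f (move p η) - f η) := by
  refine Finset.sum_congr rfl fun p _ => ?_
  unfold move occ
  cases h1 : η p.1 <;> cases h2 : η p.2 <;> simp

theorem mulVec_generator (g : ℝ) (f : Config n → ℝ) :
    LinearMap.toMatrix' (generator n g) *ᵥ f = generator n g f :=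
  LinearMap.toMatrix'_mulVec _ _

/-- After adding a multiple of the identity the generator is a nonnegative combination of the
composition operators with `move p`. -/
theorem mulVec_generator_add (g : ℝ) (f : Config n → ℝ) :
    LinearMap.toMatrix' (generator n g) *ᵥ f +
      (∑ p : ZMod n × ZMod n with Near p.1 p.2, rate g p.1) • f =
      ∑ p : ZMod n × ZMod n with Near p.1 p.2, rate g p.1 • fun η => f (move p η) := by
  funext η
  rw [mulVec_generator]
  simp only [Pi.add_apply, Pi.smul_apply, Finset.sum_apply, generator_apply, smul_eq_mul,
    Finset.sum_mul, ← Finset.sum_add_distrib]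
  exact Finset.sum_congr rfl fun _ _ => by ring

theorem exp_generator_nonneg {g : ℝ} (hg : 0 ≤ g) {s : ℝ} (hs : 0 ≤ s) {f : Config n → ℝ}
    (hf : 0 ≤ f) : 0 ≤ exp (s • LinearMap.toMatrix' (generator n g)) *ᵥ f := by
  refine exp_smul_mulVec_mem _ (∑ p : ZMod n × ZMod n with Near p.1 p.2, rate g p.1)
    {f | 0 ≤ f} isClosed_Ici (le_refl (0 : Config n → ℝ))
    (fun f (h : 0 ≤ f) f' (h' : 0 ≤ f') => add_nonneg h h')
    (fun c hc f (h : 0 ≤ f) => smul_nonneg hc h) (fun f (hf : 0 ≤ f) => ?_) s hs f hf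
  rw [Set.mem_ofPred_eq, mulVec_generator_add]
  exact Finset.sum_nonneg fun p _ => smul_nonneg (rate_nonneg hg _) fun η => hf (move p η)

/-- The exclusion process with a slow site is attractive. -/
theorem exp_generator_monotone {g : ℝ} (hg : 0 ≤ g) {s : ℝ} (hs : 0 ≤ s) {f : Config n → ℝ}
    (hf : Monotone f) : Monotone (exp (s • LinearMap.toMatrix' (generator n g)) *ᵥ f) := by
  refine exp_smul_mulVec_mem _ (∑ p : ZMod n × ZMod n with Near p.1 p.2, rate g p.1)
    {f | Monotone f} isClosed_monotone monotone_const (fun _ h _ h' => h.add h')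
    (fun c hc _ h => h.const_smul hc) (fun f hf => ?_) s hs f hf
  rw [Set.mem_ofPred_eq, mulVec_generator_add]
  intro η ζ h
  simp only [Finset.sum_apply, Pi.smul_apply, smul_eq_mul]
  exact Finset.sum_le_sum fun p _ =>
    mul_le_mul_of_nonneg_left (hf (monotone_move p h)) (rate_nonneg hg _)

theorem exp_generator_one (g s : ℝ) :
    exp (s • LinearMap.toMatrix' (generator n g)) *ᵥ (1 : Config n → ℝ) = 1 := by
  refine exp_smul_mulVec_of_mulVec_eq_zero _ _ ?_ _
  funext η
  rw [mulVec_generator, generator_apply]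
  simp

/-- The weight `∏ x, (a x if x is occupied, b x otherwise)`. -/
def weight (a b : ZMod n → ℝ) (η : Config n) : ℝ := ∏ x, if η x then a x else b x

theorem weight_nonneg {a b : ZMod n → ℝ} (ha : ∀ x, 0 ≤ a x) (hb : ∀ x, 0 ≤ b x) :
    0 ≤ weight a b := fun η => Finset.prod_nonneg fun x _ => by split_ifs; exacts [ha x, hb x]

theorem sum_weight (a b : ZMod n → ℝ) : ∑ η, weight a b η = ∏ x, (a x + b x) := by
  have := Finset.prod_univ_sum (fun _ : ZMod n => (Finset.univ : Finset Bool))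
    (fun x c => if c = true then a x else b x)
  rw [Fintype.piFinset_univ] at this
  simpa [weight] using this.symm

/-- Product measures are stochastically ordered when their densities are. -/
theorem weight_dotProduct_le {a c : ZMod n → ℝ} (ha : ∀ x, 0 ≤ a x) (hac : ∀ x, a x ≤ c x)
    (hc : ∀ x, c x ≤ 1) {f : Config n → ℝ} (h0 : 0 ≤ f) (hf : Monotone f) :
    weight a (1 - a) ⬝ᵥ f ≤ weight c (1 - c) ⬝ᵥ f := by
  have h := holley (μ := f) (f := weight a (1 - a)) (g := weight c (1 - c)) h0
    (weight_nonneg ha fun x => by have := hac x; have := hc x; simp; linarith)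
    (weight_nonneg (fun x => (ha x).trans (hac x)) fun x => by simpa using hc x) hf
    (by simp [sum_weight]) (fun η ζ => by
      simp only [weight, ← Finset.prod_mul_distrib]
      refine Finset.prod_le_prod (fun x _ => ?_) (fun x _ => ?_)
      · have h1 := ha x; have h2 := hac x; have h3 := hc x
        refine mul_nonneg ?_ ?_ <;> split_ifs <;> (try simp only [Pi.sub_apply, Pi.one_apply]) <;> linarith
      · have h1 := ha x; have h2 := hac x; have h3 := hc x
        simp only [Pi.inf_apply, Pi.sup_apply, Pi.sub_apply, Pi.one_apply]
        cases η x <;> cases ζ x <;> simp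
        -- Only the case of a particle in `η` and a hole in `ζ` remains: a(1 - c) ≤ (1 - a)c.
        nlinarith)
  simpa [dotProduct, mul_comm] using h

/-- The weight of the reversible measure of the exclusion process with a slow site. -/
def reversibleWeight (g ρ : ℝ) : Config n → ℝ := weight (fun _ => ρ) fun x => (1 - ρ) * rate g x

/-- Only the factors at x and y change, and ξ_x · ρ · (1-ρ)ξ_y is symmetric in x and y: putting the
rate on the holes balances the slow exits. -/
theorem detailed_balance (g ρ : ℝ) (η : Config n) {x y : ZMod n} (hx : η x = true)
    (hy : η y = false) :
    rate g x * reversibleWeight g ρ η = rate g y * reversibleWeight g ρ (exchange η x y) := by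
  have hxy : x ≠ y := by rintro rfl; simp [hx] at hy
  unfold reversibleWeight weight
  have hyx : y ∈ Finset.univ.erase x := by simp [hxy.symm]
  rw [← Finset.mul_prod_erase _ _ (Finset.mem_univ x), ← Finset.mul_prod_erase _ _ hyx,
    ← Finset.mul_prod_erase (Finset.univ : Finset (ZMod n)) _ (Finset.mem_univ x),
    ← Finset.mul_prod_erase (Finset.univ.erase x) _ hyx]
  have : ∀ z ∈ (Finset.univ.erase x).erase y,
      (if exchange η x y z = true then ρ else (1 - ρ) * rate g z) =
      if η z = true then ρ else (1 - ρ) * rate g z := fun z hz => by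
    simp only [Finset.mem_erase] at hz
    rw [exchange_apply, if_neg hz.2.1, if_neg hz.1]
  rw [Finset.prod_congr rfl this]
  simp only [exchange_apply, hx, hy, hxy.symm, if_true, if_false, Bool.false_eq_true]
  ring

/-- Exchanging the two sites turns the flow along `p` into the flow along `p.swap`. Since `Near` is
symmetric, gains and losses cancel in the sum over pairs. -/
theorem reversibleWeight_dotProduct_generator (g ρ : ℝ) (f : Config n → ℝ) :
    reversibleWeight g ρ ⬝ᵥ (LinearMap.toMatrix' (generator n g) *ᵥ f) = 0 := by
  rw [mulVec_generator]
  let F : ZMod n × ZMod n → Config n → ℝ := fun p η =>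
    reversibleWeight g ρ η * (rate g p.1 * occ η p.1 * (1 - occ η p.2))
  have hF : ∀ p η, F p (exchange η p.1 p.2) = F p.swap η := fun p η => by
    simp only [F, Prod.fst_swap, Prod.snd_swap]
    have e1 : exchange η p.1 p.2 p.1 = η p.2 := by simp [exchange]
    have e2 : exchange η p.1 p.2 p.2 = η p.1 := by simp [exchange]
    unfold occ
    rw [e1, e2]
    cases h1 : η p.1 <;> cases h2 : η p.2 <;> simp
    have := detailed_balance g ρ η h2 h1
    rw [exchange_comm η p.2 p.1] at this
    linarith
  have h1 : ∀ p, ∑ η, F p η * f (exchange η p.1 p.2) = ∑ η, F p.swap η * f η := fun p => by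
    let e : Config n ≃ Config n :=
      ⟨fun η => exchange η p.1 p.2, fun η => exchange η p.1 p.2,
        fun η => exchange_exchange η _ _, fun η => exchange_exchange η _ _⟩
    rw [← e.sum_comp]
    refine Finset.sum_congr rfl fun η _ => ?_
    change F p (exchange η p.1 p.2) * f (exchange (exchange η p.1 p.2) p.1 p.2) = _
    rw [hF, exchange_exchange]
  calc reversibleWeight g ρ ⬝ᵥ generator n g f
      = ∑ p : ZMod n × ZMod n with Near p.1 p.2,
          (∑ η, F p η * f (exchange η p.1 p.2) - ∑ η, F p η * f η) := by
        simp only [dotProduct, generator, LinearMap.coe_mk, AddHom.coe_mk, Finset.mul_sum]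
        rw [Finset.sum_comm]
        refine Finset.sum_congr rfl fun p _ => ?_
        rw [← Finset.sum_sub_distrib]
        exact Finset.sum_congr rfl fun η _ => by simp only [F]; ring
    _ = 0 := by
        rw [Finset.sum_sub_distrib, sub_eq_zero]
        simp only [h1]
        refine Finset.sum_equiv (Equiv.prodComm _ _) (fun p => ?_) (fun p _ => rfl)
        simp only [Finset.mem_filter, Finset.mem_univ, true_and, Equiv.prodComm_apply,
          Prod.fst_swap, Prod.snd_swap]
        unfold Near
        rw [← neg_sub p.2 p.1, neg_inj, neg_eq_zero, neg_eq_iff_eq_neg]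
        tauto

end Generator

end SlowSite

namespace SlowSite

/-! ### Drift of the first particle to the right of the slow site, and the tail of its position -/

section Lyapunov

open Matrix NormedSpace

variable {n : ℕ}

/-- The indicator of the event that the sites `0, …, k` are empty. -/
def emptyUpTo (k : ℕ) (η : Config n) : ℝ :=
  if ∀ j ≤ k, η (j : ZMod n) = false then 1 else 0

theorem emptyUpTo_nonneg (k : ℕ) (η : Config n) : 0 ≤ emptyUpTo k η := by
  unfold emptyUpTo; split_ifs <;> simp

theorem emptyUpTo_le_one (k : ℕ) (η : Config n) : emptyUpTo k η ≤ 1 := by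
  unfold emptyUpTo; split_ifs <;> simp

theorem emptyUpTo_succ_le (k : ℕ) (η : Config n) : emptyUpTo (k + 1) η ≤ emptyUpTo k η := by
  unfold emptyUpTo
  split_ifs with h1 h2
  · exact le_rfl
  · exact absurd (fun j hj => h1 j (by omega)) h2
  · exact zero_le_one
  · exact le_rfl

theorem antitone_emptyUpTo (k : ℕ) : Antitone (emptyUpTo (n := n) k) := by
  intro η ζ h
  unfold emptyUpTo
  split_ifs with h1 h2
  · exact le_rfl
  · exact absurd (fun j hj => Bool.eq_false_of_le_false ((h _).trans (h1 j hj).le)) h2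
  · exact zero_le_one
  · exact le_rfl

theorem emptyUpTo_zero (η : Config n) : emptyUpTo 0 η = 1 - occ η 0 := by
  unfold emptyUpTo occ
  cases h : η 0 <;> simp [h]

theorem natCast_zmod_inj {i j : ℕ} (hi : i < n) (hj : j < n) (h : (i : ZMod n) = j) : i = j := by
  have := (ZMod.natCast_eq_natCast_iff i j n).1 h
  rwa [Nat.ModEq, Nat.mod_eq_of_lt hi, Nat.mod_eq_of_lt hj] at this

/-- Jumps can only spoil an empty window. Of these, just the entry from k + 1 is kept; it has rate 1
because k + 1 < n keeps that site away from 0. -/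
theorem emptyUpTo_move_sub_le_of_empty {k : ℕ} (hk : k + 1 < n) (η : Config n)
    (h : ∀ j ≤ k, η (j : ZMod n) = false) (p : ZMod n × ZMod n) {g : ℝ} (hg : 0 ≤ g) :
    rate g p.1 * (emptyUpTo k (move p η) - emptyUpTo k η) ≤
      if p = (((k + 1 : ℕ) : ZMod n), (k : ZMod n)) then
        -(emptyUpTo k η - emptyUpTo (k + 1) η) else 0 := by
  have h1 : emptyUpTo k η = 1 := if_pos h
  split_ifs with hp
  · subst hp
    have h0 : ((k + 1 : ℕ) : ZMod n) ≠ 0 := fun h0 => by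
      have := natCast_zmod_inj hk (by omega) (h0.trans Nat.cast_zero.symm)
      omega
    rw [rate, if_neg h0, one_mul, h1]
    cases h2 : η ((k + 1 : ℕ) : ZMod n)
    · have : emptyUpTo (k + 1) η = 1 := if_pos fun j hj => by
        rcases Nat.lt_or_ge k j with hj' | hj'
        · obtain rfl : j = k + 1 := by omega
          exact h2
        · exact h j hj'
      rw [this]
      linarith [emptyUpTo_le_one k (move (((k + 1 : ℕ) : ZMod n), (k : ZMod n)) η)]
    · have : emptyUpTo k (move (((k + 1 : ℕ) : ZMod n), (k : ZMod n)) η) = 0 := if_neg fun h3 => by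
        have h4 := h3 k le_rfl
        rw [move_apply, if_neg, if_pos rfl] at h4
        · rw [h2, Bool.true_or] at h4; exact Bool.noConfusion h4
        · intro h5
          have := natCast_zmod_inj (by omega) hk h5
          omega
      rw [this]
      linarith [emptyUpTo_nonneg (k + 1) η]
  · refine mul_nonpos_of_nonneg_of_nonpos (rate_nonneg hg _) ?_
    rw [h1]
    linarith [emptyUpTo_le_one k (move p η)]

/-- One jump empties the window only if its sole particle leaves it. Either that particle starts at
the slow site, at cost g, or it crosses the right edge from k to k + 1, and then the sites before k
were empty. -/
theorem emptyUpTo_move_sub_le_of_not_empty {k : ℕ} (hk : k + 1 < n) (η : Config n)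
    (h : ¬ ∀ j ≤ k, η (j : ZMod n) = false) {p : ZMod n × ZMod n} (hp : Near p.1 p.2) {g : ℝ}
    (hg : 0 ≤ g) :
    rate g p.1 * (emptyUpTo k (move p η) - emptyUpTo k η) ≤
      (if p.1 = 0 then g else 0) +
      if p = ((k : ZMod n), ((k + 1 : ℕ) : ZMod n)) then
        (if k = 0 then 0 else emptyUpTo (k - 1) η - emptyUpTo k η) else 0 := by
  have h1 : emptyUpTo k η = 0 := if_neg h
  have hr := rate_nonneg hg p.1
  have hlast : 0 ≤ if p = ((k : ZMod n), ((k + 1 : ℕ) : ZMod n)) then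
        (if k = 0 then 0 else emptyUpTo (k - 1) η - emptyUpTo k η) else 0 := by
    split_ifs
    · exact le_rfl
    · rw [h1, sub_zero]; exact emptyUpTo_nonneg _ _
    · exact le_rfl
  rw [h1, sub_zero]
  by_cases h0 : p.1 = 0
  · rw [if_pos h0, rate, if_pos h0]
    have := mul_le_mul_of_nonneg_left (emptyUpTo_le_one k (move p η)) hg
    rw [h1] at hlast
    linarith
  rw [if_neg h0, zero_add, rate, if_neg h0, one_mul]
  by_cases h2 : ∀ j ≤ k, move p η (j : ZMod n) = false
  swap
  · rw [emptyUpTo, if_neg h2]; rwa [h1] at hlast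
  -- A jump vacates only its source, so every particle of the window sits there.
  have hocc : ∀ j ≤ k, η (j : ZMod n) = true → (j : ZMod n) = p.1 := fun j hj hj' => by
    by_contra hne
    have := h2 j hj
    rw [move_apply, if_neg hne, hj'] at this
    split_ifs at this with h3
    simp [← h3, hj'] at this
  push Not at h
  obtain ⟨i, hi, hi'⟩ := h
  rw [ne_eq, Bool.not_eq_false] at hi'
  have hip := hocc i hi hi'
  have hp1 : η p.1 = true := hip ▸ hi'
  have hp2 : ∀ j ≤ k, (j : ZMod n) ≠ p.2 := fun j hj hj' => by
    have h3 := h2 j hj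
    rw [move_apply, hj'] at h3
    by_cases h4 : p.2 = p.1
    · simp [h4, hp1] at h3
    · simp [h4, hp1] at h3
  have hi0 : i ≠ 0 := by rintro rfl; exact h0 (by simpa using hip.symm)
  have hp2' : p.2 = ((i + 1 : ℕ) : ZMod n) := by
    rcases hp with hp | hp | hp
    · rw [Nat.cast_succ, hip]; linear_combination -hp
    · exact absurd (by rw [hip]; linear_combination hp) (hp2 i hi)
    · refine absurd ?_ (hp2 (i - 1) (by omega))
      rw [Nat.cast_sub (by omega), hip]; push_cast; linear_combination hp
  have hik : i = k := by
    by_contra hne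
    exact hp2 (i + 1) (by omega) hp2'.symm
  subst hik
  rw [if_pos (Prod.ext hip.symm hp2'), if_neg hi0]
  have : emptyUpTo (i - 1) η = 1 := if_pos fun j hj => by
    by_contra h5
    rw [Bool.not_eq_false] at h5
    have := natCast_zmod_inj (by omega) (by omega) ((hocc j (by omega) h5).trans hip.symm)
    omega
  rw [this, sub_zero]
  exact emptyUpTo_le_one _ _

/-- The Lyapunov function: a concave increasing function of the position of the first particle to
the right of the slow site. -/
def lyapunov (l : ℕ) : Config n → ℝ := ∑ k ∈ Finset.range l, ((l : ℝ) - k) • emptyUpTo k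

theorem lyapunov_nonneg (l : ℕ) : 0 ≤ lyapunov (n := n) l := by
  refine Finset.sum_nonneg fun k hk => smul_nonneg ?_ fun η => emptyUpTo_nonneg k η
  have : (k : ℝ) ≤ l := by exact_mod_cast (Finset.mem_range.1 hk).le
  linarith

theorem lyapunov_le (l : ℕ) (η : Config n) : lyapunov l η ≤ (l : ℝ) ^ 2 := by
  simp only [lyapunov, Finset.sum_apply, Pi.smul_apply, smul_eq_mul]
  calc ∑ k ∈ Finset.range l, ((l : ℝ) - k) * emptyUpTo k η
      ≤ ∑ k ∈ Finset.range l, (l : ℝ) := Finset.sum_le_sum fun k hk => by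
        have h1 : (k : ℝ) ≤ l := by exact_mod_cast (Finset.mem_range.1 hk).le
        have h2 := emptyUpTo_le_one k η
        have h3 : (0 : ℝ) ≤ k := k.cast_nonneg
        nlinarith
    _ = (l : ℝ) ^ 2 := by simp [sq]

/-- The weights l - k turn the sum into a sum of partial sums; these are -(E (j-1) - E j) for 1 ≤ j
≤ l and telescope again. Having no inflow term at k = 0 leaves the useful -E 0. -/
theorem summation_by_parts_concave (E : ℕ → ℝ) (l : ℕ) :
    ∑ k ∈ Finset.range l, ((l : ℝ) - k) * (-(E k - E (k + 1)) +
      if k = 0 then 0 else E (k - 1) - E k) = -(E 0 - E l) := by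
  have key : ∀ l : ℕ, ∑ k ∈ Finset.range l, (-(E k - E (k + 1)) +
      if k = 0 then 0 else E (k - 1) - E k) = if l = 0 then 0 else -(E (l - 1) - E l) := by
    intro l
    induction l with
    | zero => simp
    | succ l ih =>
      rw [Finset.sum_range_succ, ih]
      by_cases hl : l = 0
      · simp [hl]
      · simp only [hl, if_false, Nat.succ_ne_zero, Nat.add_sub_cancel]; ring
  induction l with
  | zero => simp
  | succ l ih =>
    have : ∀ k ∈ Finset.range l, (((l + 1 : ℕ) : ℝ) - k) * (-(E k - E (k + 1)) +
        if k = 0 then 0 else E (k - 1) - E k) = ((l : ℝ) - k) * (-(E k - E (k + 1)) +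
        if k = 0 then 0 else E (k - 1) - E k) + (-(E k - E (k + 1)) +
        if k = 0 then 0 else E (k - 1) - E k) := fun k _ => by push_cast; ring
    rw [Finset.sum_range_succ, Finset.sum_congr rfl this, Finset.sum_add_distrib, ih, key]
    by_cases hl : l = 0
    · simp [hl]
    · simp only [hl, if_false]; push_cast; ring

variable [NeZero n]

/-- The error 3g comes from the at most three pairs in the generator's sum that start at the slow
site. -/
theorem generator_emptyUpTo_le {k : ℕ} (hk : k + 1 < n) {g : ℝ} (hg : 0 ≤ g) (η : Config n) :
    generator n g (emptyUpTo k) η ≤ -(emptyUpTo k η - emptyUpTo (k + 1) η) +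
      (if k = 0 then 0 else emptyUpTo (k - 1) η - emptyUpTo k η) + 3 * g := by
  rw [generator_apply]
  by_cases h : ∀ j ≤ k, η (j : ZMod n) = false
  · have h1 : (0 : ℝ) ≤ if k = 0 then 0 else emptyUpTo (k - 1) η - emptyUpTo k η := by
      split_ifs with hk0
      · exact le_rfl
      · have := emptyUpTo_succ_le (k - 1) η
        rw [Nat.sub_add_cancel (by omega)] at this
        linarith
    refine (Finset.sum_le_sum fun p _ => emptyUpTo_move_sub_le_of_empty hk η h p hg).trans ?_
    rw [Finset.sum_ite_eq', if_pos]
    · linarith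
    · simp [Near]
  · have h1 : emptyUpTo k η = 0 := if_neg h
    have h2 : emptyUpTo (k + 1) η = 0 :=
      le_antisymm ((emptyUpTo_succ_le k η).trans h1.le) (emptyUpTo_nonneg _ _)
    refine (Finset.sum_le_sum fun p hp =>
      emptyUpTo_move_sub_le_of_not_empty hk η h (Finset.mem_filter.1 hp).2 hg).trans ?_
    rw [Finset.sum_add_distrib, Finset.sum_ite_eq', if_pos (by simp [Near]), ← Finset.sum_filter,
      Finset.sum_const, nsmul_eq_mul, h2]
    have hcard : (((Finset.univ.filter fun p : ZMod n × ZMod n => Near p.1 p.2).filter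
        fun p => p.1 = 0).card : ℝ) ≤ 3 := by
      have hsub : ((Finset.univ.filter fun p : ZMod n × ZMod n => Near p.1 p.2).filter
        fun p => p.1 = 0) ⊆ {(0, 1), (0, 0), (0, -1)} := by
        rintro ⟨x, y⟩ hp
        simp only [Finset.mem_filter, Finset.mem_univ, true_and] at hp
        obtain ⟨hp, rfl⟩ := hp
        simp only [Near, zero_sub, neg_inj, neg_eq_zero] at hp
        simp only [Finset.mem_insert, Finset.mem_singleton, Prod.mk.injEq, true_and]
        rcases hp with hp | hp | hp
        · exact Or.inl hp
        · exact Or.inr (Or.inl hp)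
        · exact Or.inr (Or.inr (by rw [← hp, neg_neg]))
      exact_mod_cast (Finset.card_le_card hsub).trans Finset.card_le_three
    have := mul_le_mul_of_nonneg_right hcard hg
    linarith

theorem generator_lyapunov_le {l : ℕ} (hl : l < n) {g : ℝ} (hg : 0 ≤ g) (η : Config n) :
    generator n g (lyapunov l) η ≤ -emptyUpTo 0 η + (emptyUpTo l η + 3 * g * (l : ℝ) ^ 2) := by
  rw [lyapunov, map_sum, Finset.sum_apply]
  calc ∑ k ∈ Finset.range l, generator n g (((l : ℝ) - k) • emptyUpTo k) η
      ≤ ∑ k ∈ Finset.range l, (((l : ℝ) - k) * (-(emptyUpTo k η - emptyUpTo (k + 1) η) +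
          if k = 0 then 0 else emptyUpTo (k - 1) η - emptyUpTo k η) + 3 * g * l) :=
        Finset.sum_le_sum fun k hk => by
          have hk' := Finset.mem_range.1 hk
          have h1 : (k : ℝ) ≤ l := by exact_mod_cast hk'.le
          have h3 : (0 : ℝ) ≤ k := k.cast_nonneg
          rw [map_smul, Pi.smul_apply, smul_eq_mul]
          have h2 := mul_le_mul_of_nonneg_left
            (generator_emptyUpTo_le (k := k) (by omega) hg η) (sub_nonneg.2 h1)
          have h4 : ((l : ℝ) - k) * (3 * g) ≤ 3 * g * l := by nlinarith [mul_nonneg hg h3]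
          linarith
    _ = _ := by
        rw [Finset.sum_add_distrib, summation_by_parts_concave fun k => emptyUpTo k η]
        simp only [Finset.sum_const, Finset.card_range, nsmul_eq_mul]
        ring

/-- The weight factorizes: sites outside the window contribute ρ + (1-ρ) = 1, each of the l ordinary
sites inside contributes 1-ρ, and the slow site contributes (1-ρ)g. -/
theorem reversibleWeight_dotProduct_emptyUpTo {l : ℕ} (hl : l < n) (g ρ : ℝ) :
    reversibleWeight g ρ ⬝ᵥ emptyUpTo (n := n) l = (1 - ρ) * g * (1 - ρ) ^ l := by
  classical
  let W : Finset (ZMod n) := (Finset.range (l + 1)).image fun j : ℕ => (j : ZMod n)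
  have h1 : ∀ η : Config n, reversibleWeight g ρ η * emptyUpTo l η =
      -- Giving particles weight 0 on the window encodes the indicator without leaving product
      -- weights.
      weight (fun x => if x ∈ W then 0 else ρ) (fun x => (1 - ρ) * rate g x) η := fun η => by
    unfold emptyUpTo reversibleWeight weight
    split_ifs with h
    · rw [mul_one]
      refine Finset.prod_congr rfl fun x _ => ?_
      by_cases hx : x ∈ W
      · obtain ⟨j, hj, rfl⟩ := Finset.mem_image.1 hx
        simp [h j (by have := Finset.mem_range.1 hj; omega)]
      · simp [hx]
    · rw [mul_zero]
      push Not at h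
      obtain ⟨j, hj, hj'⟩ := h
      rw [ne_eq, Bool.not_eq_false] at hj'
      refine (Finset.prod_eq_zero (Finset.mem_univ (j : ZMod n)) ?_).symm
      exact (if_pos hj').trans (if_pos (Finset.mem_image_of_mem _ (Finset.mem_range.2 (by omega))))
  simp only [dotProduct, h1]
  rw [sum_weight]
  have h0 : ∀ j : ℕ, j + 1 ≤ l → ((j + 1 : ℕ) : ZMod n) ≠ 0 := fun j hj h => by
    have := natCast_zmod_inj (by omega) (by omega) (h.trans Nat.cast_zero.symm)
    omega
  have hsub : ∏ x ∈ W, ((if x ∈ W then 0 else ρ) + (1 - ρ) * rate g x) =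
      ∏ x, ((if x ∈ W then 0 else ρ) + (1 - ρ) * rate g x) := by
    refine Finset.prod_subset (Finset.subset_univ _) fun x _ hx => ?_
    have hx0 : x ≠ 0 := by
      rintro rfl
      exact hx (Finset.mem_image.2 ⟨0, by simp, by simp⟩)
    rw [if_neg hx, rate, if_neg hx0]; ring
  rw [← hsub, Finset.prod_congr rfl fun x hx => by rw [if_pos hx, zero_add],
    Finset.prod_image fun i hi j hj h => by
      have hi' := Finset.mem_range.1 hi
      have hj' := Finset.mem_range.1 hj
      exact natCast_zmod_inj (by omega) (by omega) h,
    Finset.prod_range_succ', Finset.prod_congr rfl (g := fun _ => 1 - ρ) fun j hj => by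
      rw [rate, if_neg (h0 j (by have := Finset.mem_range.1 hj; omega)), mul_one]]
  simp [rate]
  ring

/-- The probability that the sites `0, …, l` are empty decays exponentially in `l`, uniformly in
time, when the initial densities are bounded below. -/
theorem weight_dotProduct_exp_emptyUpTo_le {g ρ : ℝ} (hg : 0 < g) (hρ0 : 0 ≤ ρ) (hρ1 : ρ < 1)
    {c : ZMod n → ℝ} (hc : ∀ x, ρ ≤ c x) (hc1 : ∀ x, c x ≤ 1) {l : ℕ} (hl : l < n) {s : ℝ}
    (hs : 0 ≤ s) :
    weight c (1 - c) ⬝ᵥ (exp (s • LinearMap.toMatrix' (generator n g)) *ᵥ emptyUpTo l) ≤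
      (1 - ρ) ^ l := by
  set M := exp (s • LinearMap.toMatrix' (generator n g)) with hM
  -- With no particle at 0, comparison with the reversible weight costs only the factor ((1-ρ)g)⁻¹
  -- of the hole there.
  let a : ZMod n → ℝ := fun x => if x = 0 then 0 else ρ
  have ha : ∀ x, 0 ≤ a x := fun x => by simp only [a]; split_ifs; exacts [le_rfl, hρ0]
  have hac : ∀ x, a x ≤ c x := fun x => by
    simp only [a]; split_ifs; exacts [hρ0.trans (hc x), hc x]
  have hpos : 0 ≤ M *ᵥ emptyUpTo l := exp_generator_nonneg hg.le hs (emptyUpTo_nonneg l)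
  have hdom : weight c (1 - c) ⬝ᵥ (M *ᵥ emptyUpTo l) ≤
      weight a (1 - a) ⬝ᵥ (M *ᵥ emptyUpTo l) := by
    -- The comparison needs a nonnegative increasing function, hence the complement of the
    -- empty-window event.
    have h1 := weight_dotProduct_le ha hac hc1 (f := M *ᵥ (1 - emptyUpTo l))
      (exp_generator_nonneg hg.le hs fun η => by simpa using emptyUpTo_le_one l η)
      (exp_generator_monotone hg.le hs fun η ζ h => by
        simpa only [Pi.sub_apply, Pi.one_apply] using sub_le_sub_left (antitone_emptyUpTo l h) 1)
    rw [mulVec_sub, exp_generator_one, dotProduct_sub, dotProduct_sub, dotProduct_one, dotProduct_one, sum_weight,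
      sum_weight] at h1
    simp only [Pi.sub_apply, Pi.one_apply, add_sub_cancel, Finset.prod_const_one] at h1
    linarith
  refine hdom.trans ?_
  have hq : 0 < (1 - ρ) * g := mul_pos (by linarith) hg
  have hle : ∀ η, weight a (1 - a) η ≤ ((1 - ρ) * g)⁻¹ * reversibleWeight g ρ η := fun η => by
    have h3 : ((1 - ρ) * g)⁻¹ = ∏ x : ZMod n, if x = 0 then ((1 - ρ) * g)⁻¹ else 1 := by
      rw [Finset.prod_ite_eq' Finset.univ (0 : ZMod n) fun _ => ((1 - ρ) * g)⁻¹]; simp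
    rw [h3, reversibleWeight, weight, weight, ← Finset.prod_mul_distrib]
    refine Finset.prod_le_prod (fun x _ => ?_) fun x _ => ?_
    · simp only [a, Pi.sub_apply, Pi.one_apply]
      split_ifs <;> linarith
    · simp only [a, Pi.sub_apply, Pi.one_apply, rate]
      split_ifs
      · positivity
      · rw [one_mul]
      · rw [inv_mul_cancel₀ hq.ne', sub_zero]
      · rw [one_mul, mul_one]
  calc weight a (1 - a) ⬝ᵥ (M *ᵥ emptyUpTo l)
      ≤ (((1 - ρ) * g)⁻¹ • reversibleWeight g ρ) ⬝ᵥ (M *ᵥ emptyUpTo l) :=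
        dotProduct_le_dotProduct_of_nonneg_right hle hpos
    _ = (1 - ρ) ^ l := by
        rw [smul_dotProduct, hM, dotProduct_exp_smul_mulVec _ _
          (reversibleWeight_dotProduct_generator g ρ), reversibleWeight_dotProduct_emptyUpTo hl,
          smul_eq_mul, ← mul_assoc, inv_mul_cancel₀ hq.ne', one_mul]

end Lyapunov

end SlowSite

namespace SlowSite

/-! ### From the semigroup to path space -/

section PathMeasure

open Matrix NormedSpace

variable {n : ℕ} [NeZero n]

/-- The expected occupation time of holes at the slow site, up to time `t`. -/
theorem integral_weight_dotProduct_exp_le {g ρ : ℝ} (hg : 0 < g) (hρ0 : 0 ≤ ρ) (hρ1 : ρ < 1)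
    {c : ZMod n → ℝ} (hc : ∀ x, ρ ≤ c x) (hc1 : ∀ x, c x ≤ 1) {l : ℕ} (hl : l < n) {t : ℝ}
    (ht : 0 ≤ t) :
    ∫ s in (0 : ℝ)..t, weight c (1 - c) ⬝ᵥ
        (exp ((s * (n : ℝ) ^ 2) • LinearMap.toMatrix' (generator n g)) *ᵥ emptyUpTo 0) ≤
      (l : ℝ) ^ 2 / (n : ℝ) ^ 2 + ((1 - ρ) ^ l + 3 * g * (l : ℝ) ^ 2) * t := by
  have hn : (n : ℝ) ≠ 0 := Nat.cast_ne_zero.2 (NeZero.ne n)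
  have hw : 0 ≤ weight c (1 - c) := weight_nonneg (fun x => hρ0.trans (hc x)) fun x => by
    simpa using hc1 x
  have hw1 : ∑ η, weight c (1 - c) η = 1 := by simp [sum_weight]
  -- Dividing the Lyapunov function by n² compensates the acceleration of the generator.
  have h := integral_dotProduct_exp_le ((n : ℝ) ^ 2 • LinearMap.toMatrix' (generator n g))
    (weight c (1 - c)) (((n : ℝ) ^ 2)⁻¹ • lyapunov l) (emptyUpTo 0)
    (emptyUpTo l + (3 * g * (l : ℝ) ^ 2) • 1) ((1 - ρ) ^ l + 3 * g * (l : ℝ) ^ 2) t ht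
    (fun f hf s hs => by
      rw [smul_smul]
      exact dotProduct_nonneg_of_nonneg hw (exp_generator_nonneg hg.le (by positivity) hf))
    (smul_nonneg (by positivity) (lyapunov_nonneg l))
    (fun η => by
      rw [smul_mulVec, mulVec_smul, smul_smul, mul_inv_cancel₀ (pow_ne_zero 2 hn), one_smul,
        mulVec_generator]
      simpa using generator_lyapunov_le hl hg.le η)
    (fun s hs => by
      rw [smul_smul, mulVec_add, mulVec_smul, dotProduct_add, dotProduct_smul,
        exp_generator_one, dotProduct_one, hw1, smul_eq_mul, mul_one]
      linarith [weight_dotProduct_exp_emptyUpTo_le hg hρ0 hρ1 hc hc1 hl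
        (s := s * (n : ℝ) ^ 2) (by positivity)])
  simp only [smul_smul] at h
  refine h.trans (add_le_add_left ?_ _)
  rw [dotProduct_smul, smul_eq_mul, div_eq_inv_mul]
  refine mul_le_mul_of_nonneg_left ?_ (by positivity)
  calc weight c (1 - c) ⬝ᵥ lyapunov l ≤ weight c (1 - c) ⬝ᵥ fun _ => (l : ℝ) ^ 2 :=
        dotProduct_le_dotProduct_of_nonneg_left (fun η => lyapunov_le l η) hw
    _ = (l : ℝ) ^ 2 := by rw [dotProduct, ← Finset.sum_mul, hw1, one_mul]

theorem initialMeasure_real_singleton (γ : UnitAddCircle → unitInterval) (η : Config n) :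
    (initialMeasure n γ).real {η} =
      weight (fun x => (γ (ZMod.toAddCircle x) : ℝ)) (1 - fun x => (γ (ZMod.toAddCircle x) : ℝ))
        η := by
  rw [measureReal_def, initialMeasure, Measure.pi_singleton, ENNReal.toReal_prod, weight]
  refine Finset.prod_congr rfl fun x _ => ?_
  rw [← measureReal_def]
  cases η x <;> simp

/-- The coordinate process of the path space is jointly measurable in time and path. -/
theorem measurable_path_eval : Measurable fun p : ℝ × Path n => p.2.1 p.1.toNNReal := by
  -- The sampled times form a countable grid for each m; the + 1 puts them to the right of the true
  -- time, so right-continuity gives convergence.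
  let X : ℕ → ℝ × Path n → Config n := fun m p =>
    p.2.1 (((⌊(m + 1 : ℝ≥0) * p.1.toNNReal⌋₊ : ℝ≥0) + 1) / (m + 1 : ℝ≥0))
  refine measurable_of_tendsto_metrizable (f := X) (fun m => ?_) (tendsto_pi_nhds.2 fun p => ?_)
  · have h1 : Measurable fun p : ℝ × Path n => ⌊(m + 1 : ℝ≥0) * p.1.toNNReal⌋₊ :=
      Nat.measurable_floor.comp (measurable_const.mul measurable_fst.real_toNNReal)
    have h2 : Measurable fun q : Path n × ℕ =>
        q.1.1 (((q.2 : ℝ≥0) + 1) / (m + 1 : ℝ≥0)) :=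
      measurable_from_prod_countable_left fun k =>
        (measurable_pi_apply (((k : ℝ≥0) + 1) / (m + 1 : ℝ≥0))).comp measurable_subtype_coe
    exact h2.comp (measurable_snd.prodMk h1)
  · have hc := (p.2.2 p.1.toNNReal).1
    refine hc.tendsto.comp (tendsto_nhdsWithin_iff.2 ⟨?_, Eventually.of_forall fun m => ?_⟩)
    · have hub : Tendsto (fun m : ℕ => p.1.toNNReal + 1 / ((m : ℝ≥0) + 1)) atTop
          (𝓝 (p.1.toNNReal + 0)) :=
        tendsto_const_nhds.add tendsto_one_div_add_atTop_nhds_zero_nat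
      rw [add_zero] at hub
      refine tendsto_of_tendsto_of_tendsto_of_le_of_le tendsto_const_nhds hub (fun m => ?_)
        fun m => ?_
      · rw [le_div_iff₀ (by positivity), mul_comm]
        exact (Nat.lt_floor_add_one _).le
      · dsimp only
        have hm : ((m : ℝ≥0) + 1) ≠ 0 := by positivity
        rw [div_le_iff₀ (by positivity), add_mul (p.1.toNNReal), one_div, inv_mul_cancel₀ hm,
          mul_comm (p.1.toNNReal)]
        exact add_le_add_left (Nat.floor_le zero_le) _
    · rw [Set.mem_Ici, le_div_iff₀ (by positivity), mul_comm]
      exact (Nat.lt_floor_add_one _).le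

/-- Take expectations in the Markov property started at time 0. -/
theorem IsPathLaw.integral_eq {g : ℝ} {μ : Measure (Config n)} {P : Measure (Path n)}
    (hP : IsPathLaw n g μ P) (t : ℝ≥0) (f : Config n → ℝ) :
    ∫ ω, f (ω.1 t) ∂P = (fun η => μ.real {η}) ⬝ᵥ semigroup n g t f := by
  have := hP.isProbabilityMeasure
  have hm : Measurable fun ω : Path n => ω.1 0 :=
    (measurable_pi_apply _).comp measurable_subtype_coe
  have hμ : IsProbabilityMeasure μ := hP.initial ▸ Measure.isProbabilityMeasure_map hm.aemeasurable
  have h := integral_congr_ae (hP.markov 0 t f)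
  rw [integral_condExp (past_le n 0)] at h
  simp only [zero_add] at h
  rw [h, ← integral_map (f := semigroup n g t f) hm.aemeasurable
    (measurable_of_countable _).aestronglyMeasurable, hP.initial, integral_fintype .of_finite]
  rfl

/-- Markov's inequality for the hole time, whose mean is the time integral of the semigroup by
Fubini. -/
theorem IsPathLaw.measure_hole_time_le {g ρ : ℝ} (hg : 0 < g) (hρ0 : 0 ≤ ρ) (hρ1 : ρ < 1)
    {γ : UnitAddCircle → unitInterval} (hγ : ∀ u, ρ ≤ γ u) {P : Measure (Path n)}
    (hP : IsPathLaw n g (initialMeasure n γ) P) {l : ℕ} (hl : l < n) {t ε : ℝ} (ht : 0 < t)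
    (hε : 0 < ε) :
    P {ω | (n : ℝ) / t * (∫ s in (0 : ℝ)..t, (1 - occ (ω.1 s.toNNReal) 0)) > ε} ≤
      ENNReal.ofReal ((n : ℝ) / (t * ε) * ((l : ℝ) ^ 2 / (n : ℝ) ^ 2 +
        ((1 - ρ) ^ l + 3 * g * (l : ℝ) ^ 2) * t)) := by
  have := hP.isProbabilityMeasure
  have hn : (0 : ℝ) < n := Nat.cast_pos.2 (NeZero.pos n)
  let H : Path n → ℝ := fun ω => ∫ s in (0 : ℝ)..t, emptyUpTo 0 (ω.1 s.toNNReal)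
  have hmeas : Measurable fun p : ℝ × Path n => emptyUpTo 0 (p.2.1 p.1.toNNReal) :=
    (measurable_of_countable (emptyUpTo (n := n) 0)).comp measurable_path_eval
  have hint : Integrable (fun p : ℝ × Path n => emptyUpTo 0 (p.2.1 p.1.toNNReal))
      ((volume.restrict (Set.Ioc 0 t)).prod P) :=
    Integrable.of_bound hmeas.aestronglyMeasurable 1 (Eventually.of_forall fun p => by
      rw [Real.norm_of_nonneg (emptyUpTo_nonneg _ _)]; exact emptyUpTo_le_one _ _)
  have hH : Integrable H P := by
    have := hint.integral_prod_right
    simpa only [H, intervalIntegral.integral_of_le ht.le] using this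
  have hH0 : ∀ ω, 0 ≤ H ω := fun ω =>
    intervalIntegral.integral_nonneg ht.le fun s _ => emptyUpTo_nonneg _ _
  have hE : ∫ ω, H ω ∂P ≤
      (l : ℝ) ^ 2 / (n : ℝ) ^ 2 + ((1 - ρ) ^ l + 3 * g * (l : ℝ) ^ 2) * t := by
    refine le_trans (le_of_eq ?_) (integral_weight_dotProduct_exp_le hg hρ0 hρ1
      (c := fun x => (γ (ZMod.toAddCircle x) : ℝ)) (fun x => hγ _) (fun x => (γ _).2.2) hl ht.le)
    simp only [H, intervalIntegral.integral_of_le ht.le]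
    rw [← integral_integral_swap hint]
    refine setIntegral_congr_fun measurableSet_Ioc fun s hs => ?_
    rw [hP.integral_eq, semigroup, Real.coe_toNNReal s hs.1.le]
    congr 1
    funext η
    exact initialMeasure_real_singleton γ η
  have hsub : {ω : Path n | (n : ℝ) / t * (∫ s in (0 : ℝ)..t, (1 - occ (ω.1 s.toNNReal) 0)) > ε} ⊆
      {ω | t * ε / n ≤ H ω} := fun ω hω => by
    simp only [Set.mem_ofPred_eq, ← emptyUpTo_zero] at hω ⊢
    rw [div_le_iff₀ hn]
    have h1 : (n : ℝ) / t * H ω = H ω * n / t := by ring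
    change (n : ℝ) / t * H ω > ε at hω
    rw [h1, gt_iff_lt, lt_div_iff₀ ht] at hω
    linarith
  refine (measure_mono hsub).trans ?_
  rw [← ofReal_measureReal]
  refine ENNReal.ofReal_le_ofReal ?_
  have hM := (mul_meas_ge_le_integral_of_nonneg (Eventually.of_forall hH0) hH (t * ε / n)).trans hE
  have hpos : 0 < t * ε / n := by positivity
  calc P.real {ω | t * ε / n ≤ H ω}
      = (n : ℝ) / (t * ε) * (t * ε / n * P.real {ω | t * ε / n ≤ H ω}) := by
        field_simp
    _ ≤ _ := mul_le_mul_of_nonneg_left hM (by positivity)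

end PathMeasure

/-! ### Choice of the window and conclusion -/

/-- Windows of length `n ^ δ` with small `δ > 0` make the bound on the hole time vanish. -/
theorem exists_window (α β ρ t ε : ℝ) (hα : 0 < α) (hβ : 1 < β) (hρ0 : 0 < ρ) (hρ1 : ρ < 1)
    (ht : 0 < t) (hε : 0 < ε) :
    ∃ l : ℕ → ℕ, (∀ᶠ n in atTop, l n < n) ∧ Tendsto (fun n : ℕ => (n : ℝ) / (t * ε) *
      ((l n : ℝ) ^ 2 / (n : ℝ) ^ 2 +
        ((1 - ρ) ^ l n + 3 * (α * (n : ℝ) ^ (-β)) * (l n : ℝ) ^ 2) * t)) atTop (𝓝 0) := by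
  -- With δ = 1/m, the two lower bounds on m give 2δ < 1 and 2δ < β - 1. Integrality of m gives n =
  -- (n^δ)^m ≤ (l + 1)^m, so n(1-ρ)^l is polynomial times exponential in l.
  obtain ⟨m, hm⟩ := exists_nat_gt (max 2 (2 / (β - 1)))
  have hm2 : (2 : ℝ) < m := (le_max_left _ _).trans_lt hm
  have hmβ : 2 / (β - 1) < m := (le_max_right _ _).trans_lt hm
  have hm0 : (0 : ℝ) < m := by linarith
  have hm0' : m ≠ 0 := by rintro rfl; simp at hm0
  set δ : ℝ := (m : ℝ)⁻¹ with hδ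
  have hδ0 : 0 < δ := inv_pos.2 hm0
  have hδ1 : 2 * δ < 1 := by rw [hδ, ← div_eq_mul_inv, div_lt_one hm0]; exact hm2
  have hδβ : 2 * δ < β - 1 := by
    rw [hδ, ← div_eq_mul_inv, div_lt_comm₀ hm0 (by linarith)]; exact hmβ
  let l : ℕ → ℕ := fun n => ⌊(n : ℝ) ^ δ⌋₊
  have hle : ∀ n, (l n : ℝ) ≤ (n : ℝ) ^ δ := fun n => Nat.floor_le (by positivity)
  have hsq : ∀ n, (l n : ℝ) ^ 2 ≤ (n : ℝ) ^ (2 * δ) := fun n => by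
    rw [mul_comm, Real.rpow_mul (by positivity), Real.rpow_two]
    exact pow_le_pow_left₀ (by positivity) (hle n) 2
  have hcast := tendsto_natCast_atTop_atTop (R := ℝ)
  have hl_top : Tendsto l atTop atTop :=
    tendsto_nat_floor_atTop.comp ((tendsto_rpow_atTop hδ0).comp hcast)
  refine ⟨l, ?_, ?_⟩
  · filter_upwards [eventually_gt_atTop 1] with n hn
    have hn' : (1 : ℝ) < n := by exact_mod_cast hn
    have : (l n : ℝ) < n := (hle n).trans_lt (by
      simpa using Real.rpow_lt_rpow_of_exponent_lt hn' (show δ < 1 by linarith))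
    exact_mod_cast this
  have hzero : ∀ a : ℝ, a < 0 → Tendsto (fun n : ℕ => (n : ℝ) ^ a) atTop (𝓝 0) := fun a ha => by
    have := (tendsto_rpow_neg_atTop (neg_pos.2 ha)).comp hcast
    simpa only [neg_neg, Function.comp_def] using this
  have hexp : Tendsto (fun n : ℕ => ((l n + 1 : ℕ) : ℝ) ^ m * (1 - ρ) ^ (l n + 1)) atTop (𝓝 0) :=
    (tendsto_pow_const_mul_const_pow_of_abs_lt_one m
      (r := 1 - ρ) (by rw [abs_lt]; constructor <;> linarith)).comp
      ((tendsto_add_atTop_nat 1).comp hl_top)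
  have hsum : Tendsto (fun n : ℕ => 1 / (t * ε) * ((n : ℝ) ^ (2 * δ - 1) +
      (((l n + 1 : ℕ) : ℝ) ^ m * (1 - ρ) ^ (l n + 1) * (1 - ρ)⁻¹ +
        3 * α * (n : ℝ) ^ (2 * δ - (β - 1))) * t)) atTop (𝓝 0) := by
    have := ((hzero (2 * δ - 1) (by linarith)).add ((((hexp.mul_const (1 - ρ)⁻¹)).add
      ((hzero (2 * δ - (β - 1)) (by linarith)).const_mul (3 * α))).mul_const t)).const_mul
      (1 / (t * ε))
    simpa using this
  have h1ρ : 0 < 1 - ρ := by linarith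
  refine squeeze_zero' (Eventually.of_forall fun n => by positivity) ?_ hsum
  filter_upwards [eventually_gt_atTop 0] with n hn
  have hn' : (0 : ℝ) < n := by exact_mod_cast hn
  have h1 : (n : ℝ) * ((l n : ℝ) ^ 2 / (n : ℝ) ^ 2) ≤ (n : ℝ) ^ (2 * δ - 1) := by
    rw [Real.rpow_sub_one hn'.ne']
    calc (n : ℝ) * ((l n : ℝ) ^ 2 / (n : ℝ) ^ 2) = (l n : ℝ) ^ 2 / n := by field_simp
      _ ≤ _ := div_le_div_of_nonneg_right (hsq n) hn'.le
  have h2 : (n : ℝ) * (1 - ρ) ^ l n ≤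
      ((l n + 1 : ℕ) : ℝ) ^ m * (1 - ρ) ^ (l n + 1) * (1 - ρ)⁻¹ := by
    rw [pow_succ (1 - ρ), mul_assoc, mul_assoc, mul_inv_cancel₀ h1ρ.ne', mul_one]
    refine mul_le_mul_of_nonneg_right ?_ (by positivity)
    calc (n : ℝ) = ((n : ℝ) ^ δ) ^ m := by
          rw [← Real.rpow_natCast, ← Real.rpow_mul hn'.le, hδ, inv_mul_cancel₀ hm0.ne',
            Real.rpow_one]
      _ ≤ _ := pow_le_pow_left₀ (by positivity) (by
          push_cast; exact (Nat.lt_floor_add_one _).le) m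
  have h3 : (n : ℝ) * (3 * (α * (n : ℝ) ^ (-β)) * (l n : ℝ) ^ 2) ≤
      3 * α * (n : ℝ) ^ (2 * δ - (β - 1)) := by
    have : (n : ℝ) ^ (2 * δ - (β - 1)) = n * (n : ℝ) ^ (-β) * (n : ℝ) ^ (2 * δ) := by
      nth_rw 2 [← Real.rpow_one (n : ℝ)]
      rw [← Real.rpow_add hn', ← Real.rpow_add hn']
      congr 1; ring
    rw [this]
    calc (n : ℝ) * (3 * (α * (n : ℝ) ^ (-β)) * (l n : ℝ) ^ 2)
        = 3 * α * (n * (n : ℝ) ^ (-β)) * (l n : ℝ) ^ 2 := by ring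
      _ ≤ 3 * α * (n * (n : ℝ) ^ (-β)) * (n : ℝ) ^ (2 * δ) :=
          mul_le_mul_of_nonneg_left (hsq n) (by positivity)
      _ = _ := by ring
  calc _ = 1 / (t * ε) * ((n : ℝ) * ((l n : ℝ) ^ 2 / (n : ℝ) ^ 2) + ((n : ℝ) * (1 - ρ) ^ l n +
        (n : ℝ) * (3 * (α * (n : ℝ) ^ (-β)) * (l n : ℝ) ^ 2)) * t) := by ring
    _ ≤ _ := by gcongr

end SlowSite

theorem proposition3p5 (α β : ℝ) (hα : 0 < α) (hβ : 1 < β)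
    (γ : UnitAddCircle → unitInterval)
    (hγ_cont : ∀ u : UnitAddCircle, u ≠ 0 → ContinuousAt γ u)
    (hγ_pos : 0 < ⨅ u : UnitAddCircle, (γ u : ℝ))
    (P : ∀ n : ℕ+, Measure (SlowSite.Path n))
    (hP : ∀ n : ℕ+, SlowSite.IsPathLaw n (α * (n : ℝ) ^ (-β)) (SlowSite.initialMeasure n γ) (P n))
    (t ε : ℝ) (ht : 0 < t) (hε : 0 < ε) :
    Tendsto
      (fun n : ℕ+ => P n {ω | ((n : ℕ) : ℝ) / t *
        (∫ s in (0 : ℝ)..t, (1 - SlowSite.occ (ω.1 s.toNNReal) 0)) > ε})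
      atTop (𝓝 0) := by
  set m : ℝ := ⨅ u : UnitAddCircle, (γ u : ℝ) with hm
  have hmγ : ∀ u, m ≤ γ u := fun u => ciInf_le ⟨0, by rintro _ ⟨u, rfl⟩; exact (γ u).2.1⟩ u
  have hm1 : m ≤ 1 := (hmγ 0).trans (γ 0).2.2
  -- Half the infimum serves as ρ, so that ρ < 1 even when γ is identically 1.
  obtain ⟨l, hl, hlim⟩ := SlowSite.exists_window α β (m / 2) t ε hα hβ (by linarith)
    (by linarith) ht hε
  have hlim' := (ENNReal.tendsto_ofReal hlim).comp tendsto_PNat_val_atTop_atTop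
  rw [ENNReal.ofReal_zero] at hlim'
  refine tendsto_of_tendsto_of_tendsto_of_le_of_le' tendsto_const_nhds hlim'
    (Eventually.of_forall fun _ => zero_le) ?_
  filter_upwards [tendsto_PNat_val_atTop_atTop.eventually hl] with n hn
  have hn0 : (0 : ℝ) < (n : ℕ) := by exact_mod_cast n.pos
  exact (hP n).measure_hole_time_le (by positivity) (by linarith) (by linarith)
    (fun u => by linarith [hmγ u]) hn ht hε
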